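/- Let $d\in\{1,2,3\}$, $L>0$, $\Omega=[-L,L]^d$, and let $H^m_p(\Omega)$ ($m\in\mathbb N$) be the $2L$-periodic Sobolev space, i.e. the space of $f\in L^2(\Omega)$ (complex valued) all of whose weak derivatives of order at most $m$, tested against smooth $2L$-periodic functions, lie in $L^2(\Omega)$. Let $\mathbf S_x=\frac1{\sqrt2}\begin{bmatrix}0&1&0\\1&0&1\\0&1&0\end{bmatrix}$, $\mathbf S_y=\frac{\mathrm i}{\sqrt2}\begin{bmatrix}0&-1&0\\1&0&-1\\0&1&0\end{bmatrix}$, $\mathbf S_z=\mathrm{diag}(1,0,-1)$ be the spin-1 matrices, let $\beta_n,\beta_s\in\mathbb R$, $\Lambda=\mathrm{diag}(\mu_1,\mu_0,\mu_{-1})$ with real $\mu_j$, let $V$ be a real potential and $\Phi=(\phi_1,\phi_0,\phi_{-1})^\top$ a $\mathbb C^3$-valued function (such as the ground state of a spin-1 condensate, the $\mu_j$ being its chemical potentials), both bounded on $\Omega$. With $\rho=|\phi_1|^2+|\phi_0|^2+|\phi_{-1}|^2$ define the Bogoliubov--de Gennes operators $$\mathcal A=\big(-\tfrac12\nabla^2+V\big)\mathbf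 I_3-\Lambda+\beta_n\big(\rho\,\mathbf I_3+\Phi\Phi^{\mathsf H}\big)+\beta_s\sum_{j=x,y,z}\Big((\Phi^{\mathsf H}\mathbf S_j\Phi)\,\mathbf S_j+\mathbf S_j\Phi\Phi^{\mathsf H}\mathbf S_j^{\mathsf H}\Big),$$ $$\mathcal B=\beta_n\Phi\Phi^\top+\beta_s\sum_{j=x,y,z}\mathbf S_j\Phi\Phi^\top\mathbf S_j^\top .$$ For an even integer $N>0$ and a continuous $2L$-periodic function $F$ let $$(\mathcal I_NF)(x)=\sum_{k}\widetilde F_k W_k(x),\qquad \widetilde F_k=\frac1{N^d}\sum_{n\in\{0,\dots,N-1\}^d}F(x_n)\overline{W_k(x_n)},$$ where $k$ runs over $\{-N/2,\dots,N/2-1\}^d$, $W_k(x)=\prod_{i=1}^d e^{\mathrm i\pi k_i(x_i+L)/L}$ and $x_n=\big(-L+2Ln_i/N\big)_{i=1}^d$; on vector functions $\mathcal I_N$ acts componentwise. Let $m\in\mathbb N$ with $m>d/2+2$ and $\boldsymbol\chi=(\chi_1,\chi_0,\chi_{-1})^\top\in(H^m_p(\Omega))^3$. Then $\boldsymbol\chi$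 agrees almost everywhere on $\Omega$ with a $2L$-periodic function of class $C^2$, with which it is identified, and for $\mathcal Q=\mathcal A$ and for $\mathcal Q=\mathcal B$ there is a constant $c>0$, independent of $N$, such that for every even integer $N>0$ $$\|\mathcal Q\boldsymbol\chi-\mathcal Q(\mathcal I_N\boldsymbol\chi)\|_\infty\le c\,N^{-(m-\frac d2-2)},$$ where $\|\boldsymbol f\|_\infty=\max_j\sup_{x\in\Omega}|f_j(x)|$. -/

import Mathlib

open MeasureTheory
open scoped ENNReal Matrix ContDiff

noncomputable section

namespace SpinBdG

/-- The physical space `ℝ^d` with its Euclidean structure. -/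
abbrev Space (d : ℕ) : Type := EuclideanSpace ℝ (Fin d)

/-- The computational domain `Ω = [-L, L]^d`. -/
def box (d : ℕ) (L : ℝ) : Set (Space d) := {x | ∀ i, x i ∈ Set.Icc (-L) L}

/-- `f` is `2L`-periodic in each coordinate. -/
def IsPeriodic {d : ℕ} (L : ℝ) (f : Space d → ℂ) : Prop :=
  ∀ (i : Fin d) (x : Space d), f (x + EuclideanSpace.single i (2 * L)) = f x

/-- The classical partial derivative `∂f/∂x_i`. -/
def partialDeriv {d : ℕ} (i : Fin d) (f : Space d → ℂ) : Space d → ℂ :=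
  fun x => fderiv ℝ f x (EuclideanSpace.single i 1)

/-- `∂^α f = ∂_1^{α_1} ⋯ ∂_d^{α_d} f` for a multi-index `α`. -/
def multiDeriv {d : ℕ} (α : Fin d → ℕ) (f : Space d → ℂ) : Space d → ℂ :=
  (List.finRange d).foldr (fun i g => (partialDeriv i)^[α i] g) f

/-- `g` is the weak derivative `∂^α f` on `Ω` with periodic boundary conditions:
it is tested against all smooth `2L`-periodic functions. -/
def IsPeriodicWeakDeriv {d : ℕ} (L : ℝ) (α : Fin d → ℕ) (f g : Space d → ℂ) : Prop :=
  ∀ φ : Space d → ℂ, ContDiff ℝ ∞ φ → IsPeriodic L φ →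
    ∫ x in box d L, f x * multiDeriv α φ x =
      (-1 : ℂ) ^ (∑ i, α i) * ∫ x in box d L, g x * φ x

/-- Membership in the `2L`-periodic Sobolev space `H_p^m(Ω)`: `f ∈ L²(Ω)` has periodic weak
derivatives of every order `|α| ≤ m` in `L²(Ω)`. Only the class of `f` modulo null sets
of `Ω` matters. -/
def MemPeriodicSobolev {d : ℕ} (L : ℝ) (m : ℕ) (f : Space d → ℂ) : Prop :=
  MemLp f 2 (volume.restrict (box d L)) ∧
    ∀ α : Fin d → ℕ, ∑ i, α i ≤ m →
      ∃ g : Space d → ℂ, MemLp g 2 (volume.restrict (box d L)) ∧ IsPeriodicWeakDeriv L α f g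

/-- The plane wave `W_k(x) = ∏_i exp(i π k_i (x_i + L) / L)`. -/
def planeWave {d : ℕ} (L : ℝ) (k : Fin d → ℤ) (x : Space d) : ℂ :=
  ∏ i, Complex.exp (Complex.I * ((Real.pi * k i / L * (x i + L) : ℝ) : ℂ))

/-- The grid point `x_n = (-L + n_i h)_i` with mesh size `h = 2L/N`. -/
def gridPoint {d : ℕ} (L : ℝ) (N : ℕ) (n : Fin d → Fin N) : Space d :=
  WithLp.toLp 2 fun i => -L + ((n i : ℕ) : ℝ) * (2 * L / N)

/-- The discrete Fourier coefficient `F̃_k = N^{-d} ∑_n F(x_n) conj (W_k(x_n))`. -/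
def discreteFourierCoeff {d : ℕ} (L : ℝ) (N : ℕ) (F : Space d → ℂ) (k : Fin d → ℤ) : ℂ :=
  1 / (N : ℂ) ^ d *
    ∑ n : Fin d → Fin N, F (gridPoint L N n) * star (planeWave L k (gridPoint L N n))

/-- The frequencies `k` with `-N/2 ≤ k_i ≤ N/2 - 1` (used for even `N`). -/
def frequencies (d N : ℕ) : Finset (Fin d → ℤ) :=
  Fintype.piFinset fun _ => Finset.Ico (-((N / 2 : ℕ) : ℤ)) ((N / 2 : ℕ) : ℤ)

/-- The Fourier pseudo-spectral interpolant `I_N F = ∑_k F̃_k W_k`. -/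
def interpolant {d : ℕ} (L : ℝ) (N : ℕ) (F : Space d → ℂ) : Space d → ℂ :=
  fun x => ∑ k ∈ frequencies d N, discreteFourierCoeff L N F k * planeWave L k x

/-- The componentwise interpolant of a three-component function. -/
def vecInterpolant {d : ℕ} (L : ℝ) (N : ℕ) (χ : Space d → Fin 3 → ℂ) : Space d → Fin 3 → ℂ :=
  fun x j => interpolant L N (fun y => χ y j) x

/-- `‖χ‖_∞ = max_j sup_{x ∈ Ω} |χ_j(x)|`, as an extended nonnegative real. -/
def supNorm {d : ℕ} (L : ℝ) (χ : Space d → Fin 3 → ℂ) : ℝ≥0∞ :=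
  ⨆ j : Fin 3, ⨆ x ∈ box d L, ‖χ x j‖ₑ

/-- The spin-1 matrices `S_x, S_y, S_z`. The indices `0, 1, 2 : Fin 3` of their rows and columns
stand for the spin components `1, 0, -1`. -/
def spinMatrix : Fin 3 → Matrix (Fin 3) (Fin 3) ℂ :=
  ![(1 / (Real.sqrt 2 : ℂ)) • !![0, 1, 0; 1, 0, 1; 0, 1, 0],
    (Complex.I / (Real.sqrt 2 : ℂ)) • !![0, -1, 0; 1, 0, -1; 0, 1, 0],
    !![1, 0, 0; 0, 0, 0; 0, 0, -1]]

/-- The density `ρ = |φ_1|² + |φ_0|² + |φ_{-1}|²`. -/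
def density (φ : Fin 3 → ℂ) : ℝ := ∑ j, ‖φ j‖ ^ 2

/-- The spin vector `s_j(φ) = φ^H S_j φ`. -/
def spinVector (φ : Fin 3 → ℂ) (j : Fin 3) : ℂ := star φ ⬝ᵥ (spinMatrix j *ᵥ φ)

/-- `β_n (ρ I + φ φ^H) + β_s (S·s(φ) + ∑_j S_j φ φ^H S_j^H)`. -/
def coeffA (βn βs : ℝ) (φ : Fin 3 → ℂ) : Matrix (Fin 3) (Fin 3) ℂ :=
  (βn : ℂ) • ((density φ : ℂ) • (1 : Matrix (Fin 3) (Fin 3) ℂ) + Matrix.vecMulVec φ (star φ)) +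
    (βs : ℂ) • (∑ j, spinVector φ j • spinMatrix j +
      ∑ j, spinMatrix j * Matrix.vecMulVec φ (star φ) * (spinMatrix j)ᴴ)

/-- `β_n φ φ^T + β_s ∑_j S_j φ φ^T S_j^T`. -/
def coeffB (βn βs : ℝ) (φ : Fin 3 → ℂ) : Matrix (Fin 3) (Fin 3) ℂ :=
  (βn : ℂ) • Matrix.vecMulVec φ φ +
    (βs : ℂ) • ∑ j, spinMatrix j * Matrix.vecMulVec φ φ * (spinMatrix j)ᵀ

/-- The operator `𝒜 = (-½∇² + V) I - diag(μ) + coeffA(Φ)`. -/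
def opA {d : ℕ} (V : Space d → ℝ) (μ : Fin 3 → ℝ) (βn βs : ℝ) (Φ : Space d → Fin 3 → ℂ)
    (χ : Space d → Fin 3 → ℂ) : Space d → Fin 3 → ℂ :=
  fun x j =>
    -(1 / 2 : ℂ) * Laplacian.laplacian (fun y => χ y j) x + (V x : ℂ) * χ x j - (μ j : ℂ) * χ x j
      + (coeffA βn βs (Φ x) *ᵥ χ x) j

/-- The operator `ℬ` of multiplication by `coeffB(Φ)`. -/
def opB {d : ℕ} (βn βs : ℝ) (Φ : Space d → Fin 3 → ℂ)
    (χ : Space d → Fin 3 → ℂ) : Space d → Fin 3 → ℂ :=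
  fun x => coeffB βn βs (Φ x) *ᵥ χ x

end SpinBdG

end

/-!
The Fourier coefficients `a k` of `f ∈ H^m_p` satisfy `∑ (‖k‖ ^ m * ‖a k‖) ^ 2 < ∞`, by testing
the weak derivatives `∂_i^m f` against `W_{-k}` and Parseval's identity. By Cauchy–Schwarz
`∑ ‖k‖ ^ n * ‖a k‖ < ∞` as soon as `m > d / 2 + n`; for `n = 2` the Fourier series is the `C²`
representative of `f`.

On the grid `W_k` agrees with `W_l`, where `l` is the representative of `k` modulo `N` with
components in `[-N/2, N/2)`, so interpolation replaces `W_k` by `W_l`. Only the frequencies with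
`‖k‖ ≥ N / 2` contribute to the error, and since `‖l‖ ≤ ‖k‖` its derivatives of order `n` are
bounded by a multiple of `∑_{‖k‖ ≥ N / 2} ‖k‖ ^ n * ‖a k‖`. With `p = m - n`, Cauchy–Schwarz and
the lattice tail `∑_{‖k‖ ≥ M} ‖k‖ ^ (-2 * p) = O(M ^ (d - 2 * p))` turn this into
`O(N ^ (-(m - d / 2 - n)))`. The tail bound itself comes from dividing `k` by `M` with remainder:
each quotient occurs `M ^ d` times.

Both operators are of the form `κ ∇² + M(x)` with `M` bounded on `Ω`, so the cases `n = 0` and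
`n = 2` suffice.
-/

noncomputable section

namespace SpinBdG

section PlaneWave

theorem norm_iteratedFDeriv_cexp_mul_I_le {E : Type*} [NormedAddCommGroup E] [NormedSpace ℝ E]
    (φ : E →L[ℝ] ℝ) (n : ℕ) (x : E) :
    ‖iteratedFDeriv ℝ n (fun y => Complex.exp (φ y * Complex.I)) x‖ ≤ ‖φ‖ ^ n := by
  let e : ℝ → ℂ := fun t => Complex.exp (t * Complex.I)
  have he : ContDiff ℝ n e := (Complex.ofRealCLM.contDiff.mul contDiff_const).cexp
  have hderiv : iteratedDeriv n e = fun t => Complex.I ^ n * e t := by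
    clear he
    induction n with
    | zero => simp
    | succ n ih =>
      ext t
      have : HasDerivAt e (e t * (1 * Complex.I)) t :=
        (Complex.ofRealCLM.hasDerivAt.mul_const Complex.I).cexp
      rw [iteratedDeriv_succ, ih, (this.const_mul _).deriv]
      ring
  calc ‖iteratedFDeriv ℝ n (e ∘ φ) x‖
      = ‖(iteratedFDeriv ℝ n e (φ x)).compContinuousLinearMap fun _ => φ‖ := by
        rw [φ.iteratedFDeriv_comp_right he x le_rfl]
    _ ≤ ‖iteratedFDeriv ℝ n e (φ x)‖ * ∏ _ : Fin n, ‖φ‖ :=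
        ContinuousMultilinearMap.norm_compContinuousLinearMap_le _ _
    _ = ‖φ‖ ^ n := by
        simp [norm_iteratedFDeriv_eq_norm_iteratedDeriv, hderiv, e, Complex.norm_exp_ofReal_mul_I]

variable {d : ℕ} {L : ℝ}

/-- The linear form `x ↦ ∑ i, π k_i x_i / L`, through which the plane wave `W_k` oscillates. -/
def phase (L : ℝ) (k : Fin d → ℤ) : Space d →L[ℝ] ℝ :=
  ∑ i, (Real.pi * k i / L) • EuclideanSpace.proj i

theorem phase_apply (k : Fin d → ℤ) (x : Space d) :
    phase L k x = ∑ i, Real.pi * k i / L * x i := by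
  simp [phase]

theorem phase_single (k : Fin d → ℤ) (i : Fin d) (t : ℝ) :
    phase L k (EuclideanSpace.single i t) = Real.pi * k i / L * t := by
  simp [phase_apply]

theorem norm_phase_le (k : Fin d → ℤ) : ‖phase L k‖ ≤ d * (Real.pi / |L|) * ‖k‖ := by
  have hproj (i : Fin d) : ‖(EuclideanSpace.proj i : Space d →L[ℝ] ℝ)‖ ≤ 1 :=
    ContinuousLinearMap.opNorm_le_bound _ zero_le_one fun x => by
      simpa using PiLp.norm_apply_le x i
  have hk (i : Fin d) : ‖Real.pi * k i / L‖ ≤ Real.pi / |L| * ‖k‖ := by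
    have : |(k i : ℝ)| ≤ ‖k‖ := by simpa only [Int.norm_eq_abs] using norm_le_pi_norm k i
    rw [Real.norm_eq_abs, abs_div, abs_mul, abs_of_pos Real.pi_pos, mul_div_right_comm]
    gcongr
  calc ‖phase L k‖ ≤ ∑ _ : Fin d, Real.pi / |L| * ‖k‖ * 1 := by
        refine norm_sum_le_of_le _ fun i _ => ?_
        rw [norm_smul]
        exact mul_le_mul (hk i) (hproj i) (norm_nonneg _) (by positivity)
    _ = d * (Real.pi / |L|) * ‖k‖ := by
        simp [mul_assoc]

theorem planeWave_eq_mul_cexp_phase (k : Fin d → ℤ) :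
    (planeWave L k : Space d → ℂ) =
      fun x => planeWave L k 0 * Complex.exp (phase L k x * Complex.I) := by
  ext x
  simp only [planeWave, ← Complex.exp_sum, ← Complex.exp_add, phase_apply, Complex.ofReal_sum,
    Finset.sum_mul, ← Finset.sum_add_distrib]
  refine congrArg _ (Finset.sum_congr rfl fun i _ => ?_)
  simp only [PiLp.zero_apply]
  push_cast
  ring

theorem contDiff_cexp_phase_mul_I {n : WithTop ℕ∞} (k : Fin d → ℤ) :
    ContDiff ℝ n fun x : Space d => Complex.exp (phase L k x * Complex.I) :=
  ((Complex.ofRealCLM ∘L phase L k).contDiff.mul contDiff_const).cexp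

theorem norm_planeWave (k : Fin d → ℤ) (x : Space d) : ‖planeWave L k x‖ = 1 := by
  simp only [planeWave, norm_prod, Complex.norm_exp_I_mul_ofReal, Finset.prod_const_one]

theorem contDiff_planeWave {n : WithTop ℕ∞} (k : Fin d → ℤ) :
    ContDiff ℝ n (planeWave L k : Space d → ℂ) := by
  rw [planeWave_eq_mul_cexp_phase]
  exact contDiff_const.mul (contDiff_cexp_phase_mul_I k)

theorem isPeriodic_planeWave (hL : L ≠ 0) (k : Fin d → ℤ) : IsPeriodic L (planeWave L k) := by
  intro i x
  have hphase : (phase L k (EuclideanSpace.single i (2 * L)) : ℂ) * Complex.I =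
      k i * (2 * Real.pi * Complex.I) := by
    rw [phase_single, show Real.pi * k i / L * (2 * L) = k i * (2 * Real.pi) by field_simp]
    push_cast
    ring
  rw [planeWave_eq_mul_cexp_phase]
  simp only [map_add, Complex.ofReal_add, add_mul,
    Complex.exp_add, hphase, Complex.exp_int_mul_two_pi_mul_I, mul_one]

theorem planeWave_add (k l : Fin d → ℤ) (x : Space d) :
    planeWave L (k + l) x = planeWave L k x * planeWave L l x := by
  simp only [planeWave, ← Finset.prod_mul_distrib, ← Complex.exp_add, Pi.add_apply]
  refine Finset.prod_congr rfl fun i _ => congrArg _ ?_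
  push_cast
  ring

theorem planeWave_neg (k : Fin d → ℤ) (x : Space d) :
    planeWave L (-k) x = star (planeWave L k x) := by
  simp only [planeWave, star_prod, Complex.star_def, ← Complex.exp_conj, map_mul, Complex.conj_I,
    Complex.conj_ofReal, Pi.neg_apply]
  refine Finset.prod_congr rfl fun i _ => congrArg _ ?_
  push_cast
  ring

theorem norm_iteratedFDeriv_planeWave_le (k : Fin d → ℤ) (n : ℕ) (x : Space d) :
    ‖iteratedFDeriv ℝ n (planeWave L k) x‖ ≤ (d * (Real.pi / |L|) * ‖k‖) ^ n := by
  rw [planeWave_eq_mul_cexp_phase]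
  calc ‖iteratedFDeriv ℝ n (planeWave L k 0 • fun y => Complex.exp (phase L k y * Complex.I)) x‖
      = ‖iteratedFDeriv ℝ n (fun y => Complex.exp (phase L k y * Complex.I)) x‖ := by
        rw [iteratedFDeriv_const_smul_apply (contDiff_cexp_phase_mul_I k).contDiffAt, norm_smul,
          norm_planeWave, one_mul]
    _ ≤ ‖phase L k‖ ^ n := norm_iteratedFDeriv_cexp_mul_I_le _ n x
    _ ≤ (d * (Real.pi / |L|) * ‖k‖) ^ n := by
        gcongr
        exact norm_phase_le k

theorem partialDeriv_const_mul_planeWave (i : Fin d) (c : ℂ) (k : Fin d → ℤ) :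
    partialDeriv i (fun x => c * planeWave L k x) =
      fun x => c * (Complex.I * (Real.pi * k i / L : ℝ)) * planeWave L k x := by
  ext x
  have hexp : HasFDerivAt (fun y : Space d => Complex.exp (phase L k y * Complex.I)) _ x :=
    ((Complex.ofRealCLM ∘L phase L k).hasFDerivAt.mul_const Complex.I).cexp
  rw [planeWave_eq_mul_cexp_phase, partialDeriv,
    ((hexp.const_mul (planeWave L k 0)).const_mul c).fderiv]
  simp [phase_single]
  ring

theorem iterate_partialDeriv_const_mul_planeWave (i : Fin d) (n : ℕ) (c : ℂ) (k : Fin d → ℤ) :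
    (partialDeriv i)^[n] (fun x => c * planeWave L k x) =
      fun x => (Complex.I * (Real.pi * k i / L : ℝ)) ^ n * c * planeWave L k x := by
  induction n generalizing c with
  | zero => simp
  | succ n ih =>
    rw [Function.iterate_succ_apply, partialDeriv_const_mul_planeWave, ih]
    ext x
    ring

theorem multiDeriv_planeWave (α : Fin d → ℕ) (k : Fin d → ℤ) :
    multiDeriv α (planeWave L k) =
      fun x => (∏ i, (Complex.I * (Real.pi * k i / L : ℝ)) ^ α i) * planeWave L k x := by
  rw [multiDeriv, Fin.prod_univ_def]
  induction List.finRange d with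
  | nil => simp
  | cons i l ih =>
    rw [List.foldr_cons, ih, iterate_partialDeriv_const_mul_planeWave, List.map_cons,
      List.prod_cons]

end PlaneWave

section Torus

-- Mathlib states the Fourier theory of `UnitAddTorus` over these instances, which it keeps local.
local instance : MeasureSpace UnitAddCircle := ⟨AddCircle.haarAddCircle⟩

local instance : Measure.IsAddHaarMeasure (volume : Measure UnitAddCircle) :=
  inferInstanceAs (Measure.IsAddHaarMeasure AddCircle.haarAddCircle)

local instance : IsProbabilityMeasure (volume : Measure UnitAddCircle) :=
  inferInstanceAs (IsProbabilityMeasure AddCircle.haarAddCircle)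

section UnitAddTorus

variable {ι : Type*} [Fintype ι] {g : UnitAddTorus ι → ℂ}

theorem mFourierCoeff_toLp_eq (hg : MemLp g 2 volume) (k : ι → ℤ) :
    UnitAddTorus.mFourierCoeff (hg.toLp g) k = UnitAddTorus.mFourierCoeff g k :=
  integral_congr_ae (ae_eq_rfl.mul hg.coeFn_toLp)

theorem summable_sq_mFourierCoeff (hg : MemLp g 2 volume) :
    Summable fun k => ‖UnitAddTorus.mFourierCoeff g k‖ ^ 2 := by
  simpa only [mFourierCoeff_toLp_eq] using
    (UnitAddTorus.hasSum_sq_mFourierCoeff (hg.toLp g)).summable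

theorem tsum_mFourierCoeff_mul_mFourier_ae_eq (hg : MemLp g 2 volume)
    (hs : Summable fun k => ‖UnitAddTorus.mFourierCoeff g k‖) :
    (fun t => ∑' k, UnitAddTorus.mFourierCoeff g k * UnitAddTorus.mFourier k t) =ᵐ[volume] g := by
  have hsum : Summable fun k => UnitAddTorus.mFourierCoeff g k • UnitAddTorus.mFourier k :=
    .of_norm (by simpa only [norm_smul, UnitAddTorus.mFourier_norm, mul_one] using hs)
  have hL2 : HasSum
      (fun k => UnitAddTorus.mFourierCoeff g k • UnitAddTorus.mFourierLp 2 k) (hg.toLp g) := by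
    simpa only [mFourierCoeff_toLp_eq] using UnitAddTorus.hasSum_mFourier_series_L2 (hg.toLp g)
  have htoLp := ((ContinuousMap.toLp 2 (volume : Measure (UnitAddTorus ι)) ℂ).hasSum
    hsum.hasSum).unique (by simpa only [Function.comp_def, map_smul] using hL2)
  filter_upwards [ContinuousMap.coeFn_toLp (𝕜 := ℂ) (p := 2) volume
    (∑' k, UnitAddTorus.mFourierCoeff g k • UnitAddTorus.mFourier k), hg.coeFn_toLp] with t hG ht
  rw [← ht, ← htoLp, hG, ← ContinuousMap.tsum_apply hsum]
  rfl

end UnitAddTorus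

variable {d : ℕ} {L : ℝ}

/-- The affine map of `[0, 1]^d` onto `Ω = [-L, L]^d`. -/
def ofUnitBox (L : ℝ) (x : Space d) : Space d := (2 * L) • x - WithLp.toLp 2 fun _ => L

/-- The inverse of the periodic quotient map from `(-L, L]^d` to the torus `(ℝ / ℤ)^d`, by which
functions on `Ω` are transplanted to the torus. -/
def ofTorus (L : ℝ) (t : UnitAddTorus (Fin d)) : Space d :=
  ofUnitBox L (WithLp.toLp 2 (UnitAddTorus.measurableEquivPiIoc 0 t))

/-- Lebesgue measure on `Ω`, normalized to a probability measure. -/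
def boxMeasure (d : ℕ) (L : ℝ) : Measure (Space d) :=
  ENNReal.ofReal |((2 * L) ^ d)⁻¹| • volume.restrict (box d L)

theorem measurableSet_box : MeasurableSet (box d L) := by
  simp only [box, Set.ofPred_forall]
  exact .iInter fun i => measurableSet_Icc.preimage (by fun_prop)

theorem measurableEmbedding_ofUnitBox (hL : L ≠ 0) :
    MeasurableEmbedding (ofUnitBox L : Space d → Space d) :=
  ((Homeomorph.smulOfNeZero (2 * L) (mul_ne_zero two_ne_zero hL)).trans
    (Homeomorph.subRight _)).measurableEmbedding

theorem measurePreserving_ofUnitBox (hL : L ≠ 0) :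
    MeasurePreserving (ofUnitBox L : Space d → Space d) volume
      (ENNReal.ofReal |((2 * L) ^ d)⁻¹| • volume) := by
  have hscale : MeasurePreserving (fun x : Space d => (2 * L) • x) volume
      (ENNReal.ofReal |((2 * L) ^ d)⁻¹| • volume) := by
    refine ⟨by fun_prop, ?_⟩
    rw [Measure.map_addHaar_smul _ (mul_ne_zero two_ne_zero hL), finrank_euclideanSpace_fin]
  exact ((measurePreserving_sub_right volume (WithLp.toLp 2 fun _ => L)).smul_measure _).comp hscale

theorem ofUnitBox_preimage_box (hL : 0 < L) :
    ofUnitBox L ∘ WithLp.toLp 2 ⁻¹' box d L = Set.Icc (0 : Fin d → ℝ) 1 := by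
  ext x
  simp only [ofUnitBox, box, Set.mem_preimage, Function.comp_apply, Set.mem_ofPred_eq,
    Set.mem_Icc, Pi.le_def, ← forall_and, PiLp.sub_apply, PiLp.smul_apply, smul_eq_mul,
    Pi.zero_apply, Pi.one_apply]
  refine forall_congr' fun i => and_congr ?_ ?_ <;> constructor <;> intro h <;> nlinarith

theorem measurableEmbedding_ofTorus (hL : L ≠ 0) :
    MeasurableEmbedding (ofTorus L : UnitAddTorus (Fin d) → Space d) :=
  ((measurableEmbedding_ofUnitBox hL).comp
    (MeasurableEquiv.toLp 2 (Fin d → ℝ)).measurableEmbedding).comp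
    ((MeasurableEmbedding.subtype_coe (.univ_pi' fun _ => measurableSet_Ioc)).comp
      (UnitAddTorus.measurableEquivPiIoc 0).measurableEmbedding)

theorem measurePreserving_ofTorus (hL : 0 < L) :
    MeasurePreserving (ofTorus L) volume (boxMeasure d L) := by
  have hunit : MeasurePreserving
      (fun t : UnitAddTorus (Fin d) => (UnitAddTorus.measurableEquivPiIoc 0 t : Fin d → ℝ))
      volume (volume.restrict (Set.Icc 0 1)) := by
    have hIoc : {x : Fin d → ℝ | ∀ i, x i ∈ Set.Ioc 0 (0 + 1)} =ᵐ[volume] Set.Icc 0 1 := by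
      simpa [Set.pi] using! Measure.univ_pi_Ioc_ae_eq_Icc (μ := fun _ : Fin d => volume)
        (f := 0) (g := 1)
    rw [← Measure.restrict_congr_set hIoc]
    exact (measurePreserving_subtype_coe (.univ_pi' fun _ => measurableSet_Ioc)).comp
      (UnitAddTorus.measurePreserving_equivPiIoc 0)
  have hbox := ((measurePreserving_ofUnitBox hL.ne').comp
    (PiLp.volume_preserving_toLp (Fin d))).restrict_preimage (measurableSet_box (L := L))
  rw [Measure.restrict_smul, ofUnitBox_preimage_box hL] at hbox
  exact hbox.comp hunit

theorem mFourier_eq_planeWave_ofTorus (hL : L ≠ 0) (k : Fin d → ℤ) (t : UnitAddTorus (Fin d)) :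
    UnitAddTorus.mFourier k t = planeWave L k (ofTorus L t) := by
  obtain ⟨y, rfl⟩ := (UnitAddTorus.measurableEquivPiIoc 0).symm.surjective t
  have hL' : (L : ℂ) ≠ 0 := by exact_mod_cast hL
  rw [ofTorus, MeasurableEquiv.apply_symm_apply]
  simp only [UnitAddTorus.coe_symm_measurableEquivPiIoc,
    UnitAddTorus.mFourier, ContinuousMap.coe_mk, planeWave, fourier_coe_apply, ofUnitBox]
  refine Finset.prod_congr rfl fun i _ => congrArg _ ?_
  simp only [PiLp.sub_apply, PiLp.smul_apply, smul_eq_mul]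
  push_cast
  field_simp
  ring

/-- The Fourier coefficient `(2L)^{-d} ∫_Ω f W_{-k}` of a function on `Ω`. -/
def boxFourierCoeff (L : ℝ) (f : Space d → ℂ) (k : Fin d → ℤ) : ℂ :=
  ∫ x, f x * planeWave L (-k) x ∂boxMeasure d L

theorem mFourierCoeff_comp_ofTorus (hL : 0 < L) (f : Space d → ℂ) (k : Fin d → ℤ) :
    UnitAddTorus.mFourierCoeff (f ∘ ofTorus L) k = boxFourierCoeff L f k := by
  rw [boxFourierCoeff, ← (measurePreserving_ofTorus hL).integral_comp
    (measurableEmbedding_ofTorus hL.ne')]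
  refine integral_congr_ae (.of_forall fun t => ?_)
  simp only [mFourier_eq_planeWave_ofTorus hL.ne', smul_eq_mul, Function.comp_apply, mul_comm]

theorem memLp_comp_ofTorus (hL : 0 < L) {f : Space d → ℂ}
    (hf : MemLp f 2 (volume.restrict (box d L))) : MemLp (f ∘ ofTorus L) 2 volume :=
  (hf.smul_measure ENNReal.ofReal_ne_top).comp_measurePreserving (measurePreserving_ofTorus hL)

theorem summable_sq_boxFourierCoeff (hL : 0 < L) {f : Space d → ℂ}
    (hf : MemLp f 2 (volume.restrict (box d L))) :
    Summable fun k => ‖boxFourierCoeff L f k‖ ^ 2 := by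
  simpa only [mFourierCoeff_comp_ofTorus hL] using
    summable_sq_mFourierCoeff (memLp_comp_ofTorus hL hf)

theorem tsum_boxFourierCoeff_mul_planeWave_ae_eq (hL : 0 < L) {f : Space d → ℂ}
    (hf : MemLp f 2 (volume.restrict (box d L)))
    (hs : Summable fun k => ‖boxFourierCoeff L f k‖) :
    (fun x => ∑' k, boxFourierCoeff L f k * planeWave L k x) =ᵐ[volume.restrict (box d L)] f := by
  have htorus := tsum_mFourierCoeff_mul_mFourier_ae_eq (memLp_comp_ofTorus hL hf)
    (by simpa only [mFourierCoeff_comp_ofTorus hL] using hs)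
  simp only [mFourierCoeff_comp_ofTorus hL, mFourier_eq_planeWave_ofTorus hL.ne'] at htorus
  have hbox : ∀ᵐ x ∂boxMeasure d L, ∑' k, boxFourierCoeff L f k * planeWave L k x = f x := by
    rwa [← (measurePreserving_ofTorus hL).map_eq,
      (measurableEmbedding_ofTorus hL.ne').ae_map_iff]
  have hvol : ENNReal.ofReal |((2 * L) ^ d)⁻¹| ≠ 0 :=
    (ENNReal.ofReal_pos.2 (by positivity)).ne'
  exact (Measure.ae_ennreal_smul_measure_iff hvol).1 hbox

end Torus

section Lattice

theorem summable_mul_of_summable_sq {κ : Type*} {f g : κ → ℝ} (hf₀ : ∀ k, 0 ≤ f k)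
    (hg₀ : ∀ k, 0 ≤ g k) (hf : Summable fun k => f k ^ 2) (hg : Summable fun k => g k ^ 2) :
    Summable fun k => f k * g k :=
  Real.summable_mul_of_Lp_Lq_of_nonneg .two_two hf₀ hg₀ (by simpa only [Real.rpow_two] using hf)
    (by simpa only [Real.rpow_two] using hg)

theorem tsum_mul_le_sqrt_mul_sqrt {κ : Type*} {f g : κ → ℝ} (hf₀ : ∀ k, 0 ≤ f k)
    (hg₀ : ∀ k, 0 ≤ g k) (hf : Summable fun k => f k ^ 2) (hg : Summable fun k => g k ^ 2) :
    ∑' k, f k * g k ≤ √(∑' k, f k ^ 2) * √(∑' k, g k ^ 2) := by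
  have := Real.inner_le_Lp_mul_Lq_tsum_of_nonneg .two_two hf₀ hg₀
    (by simpa only [Real.rpow_two] using hf) (by simpa only [Real.rpow_two] using hg)
  simpa only [Real.rpow_two, ← Real.sqrt_eq_rpow] using this

variable {ι : Type*} [Fintype ι]

theorem one_le_norm_of_ne_zero {k : ι → ℤ} (hk : k ≠ 0) : 1 ≤ ‖k‖ := by
  obtain ⟨i, hi⟩ := Function.ne_iff.1 hk
  refine le_trans ?_ (norm_le_pi_norm k i)
  rw [Int.norm_eq_abs]
  exact_mod_cast Int.one_le_abs hi

theorem summable_inv_norm_pow {s : ℕ} (hs : Fintype.card ι < s) :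
    Summable fun k : ι → ℤ => ‖k‖⁻¹ ^ s := by
  classical
  let b := Pi.basisFun ℝ ι
  let Λ := Submodule.span ℤ (Set.range b)
  have hrank : Module.finrank ℤ Λ = Fintype.card ι := by
    rw [ZLattice.rank ℝ Λ, Module.finrank_fintype_fun_eq_card]
  let incl (k : ι → ℤ) : Λ := ∑ i, k i • b.restrictScalars ℤ i
  have hincl (k : ι → ℤ) : ((incl k : Λ) : ι → ℝ) = fun i => (k i : ℝ) := by
    ext j
    simp [incl, b, Pi.single_apply]
  have hinj : Function.Injective incl := fun k l h => by
    ext i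
    exact_mod_cast congrFun ((hincl k).symm.trans ((congrArg Subtype.val h).trans (hincl l))) i
  have hnorm (k : ι → ℤ) : ‖incl k‖ = ‖k‖ := by
    rw [← Submodule.norm_coe, hincl, Pi.norm_def, Pi.norm_def]
    rfl
  simpa only [Function.comp_def, hnorm] using
    (ZLattice.summable_norm_pow_inv Λ s (by rwa [hrank])).comp_injective hinj

theorem norm_ediv_le {M : ℕ} (hM : 0 < M) (k : ι → ℤ) :
    ‖fun i => k i / (M : ℤ)‖ ≤ ‖k‖ / M + 1 := by
  have hM' : (0 : ℝ) < M := by exact_mod_cast hM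
  refine (pi_norm_le_iff_of_nonneg (by positivity)).2 fun i => ?_
  have hk := abs_le.1 ((Int.norm_eq_abs (k i)).ge.trans (norm_le_pi_norm k i))
  have hlower : (M : ℝ) * (k i / (M : ℤ) : ℤ) ≤ k i := by
    exact_mod_cast Int.mul_ediv_self_le (x := k i) (by omega)
  have hupper : (k i : ℝ) < M * (k i / (M : ℤ) : ℤ) + M := by
    exact_mod_cast Int.lt_mul_ediv_self_add (x := k i) (by omega)
  rw [Int.norm_eq_abs, div_add_one hM'.ne', le_div_iff₀ hM', ← abs_of_pos hM', ← abs_mul,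
    abs_of_pos hM', abs_le]
  constructor <;> linarith [hk.1, hk.2]

theorem ediv_ne_zero_of_le_norm {M : ℕ} (hM : 0 < M) {k : ι → ℤ} (hk : (M : ℝ) ≤ ‖k‖) :
    (fun i => k i / (M : ℤ)) ≠ 0 := by
  refine fun h => hk.not_gt ((pi_norm_lt_iff (by exact_mod_cast hM)).2 fun i => ?_)
  have hi : k i / (M : ℤ) = 0 := congrFun h i
  have hlower := Int.mul_ediv_self_le (x := k i) (k := M) (by omega)
  have hupper := Int.lt_mul_ediv_self_add (x := k i) (k := M) (by omega)
  rw [hi, mul_zero] at hlower hupper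
  rw [Int.norm_eq_abs, abs_of_nonneg (by exact_mod_cast hlower)]
  exact_mod_cast hupper.trans_eq (zero_add _)

theorem inv_norm_pow_le_of_le_norm (s : ℕ) {M : ℕ} (hM : 0 < M) {k : ι → ℤ}
    (hk : (M : ℝ) ≤ ‖k‖) :
    ‖k‖⁻¹ ^ s ≤ (2 / (M : ℝ)) ^ s * ‖fun i => k i / (M : ℤ)‖⁻¹ ^ s := by
  have hM' : (0 : ℝ) < M := by exact_mod_cast hM
  have hk₀ : 0 < ‖k‖ := hM'.trans_le hk
  have hq₀ := norm_pos_iff.2 (ediv_ne_zero_of_le_norm hM hk)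
  have hq : ‖fun i => k i / (M : ℤ)‖ ≤ 2 / M * ‖k‖ :=
    calc ‖fun i => k i / (M : ℤ)‖ ≤ ‖k‖ / M + 1 := norm_ediv_le hM k
      _ ≤ ‖k‖ / M + ‖k‖ / M := by gcongr; rwa [one_le_div hM']
      _ = 2 / M * ‖k‖ := by ring
  rw [← mul_pow]
  gcongr
  rwa [inv_le_iff_one_le_mul₀ hk₀, mul_right_comm, ← div_eq_mul_inv, one_le_div hq₀]

theorem exists_tsum_inv_norm_pow_le {s : ℕ} (hs : Fintype.card ι < s) :
    ∃ C : ℝ, 0 ≤ C ∧ ∀ M : ℕ, 0 < M →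
      ∑' k : {k : ι → ℤ // (M : ℝ) ≤ ‖k‖}, ‖k.1‖⁻¹ ^ s ≤
        C * (M : ℝ) ^ ((Fintype.card ι : ℝ) - s) := by
  classical
  refine ⟨2 ^ s * ∑' q : ι → ℤ, ‖q‖⁻¹ ^ s, by positivity, fun M hM => ?_⟩
  have : NeZero M := ⟨hM.ne'⟩
  have hM' : (0 : ℝ) < M := by exact_mod_cast hM
  let divMod : (ι → ℤ) ≃ (ι → ℤ) × (ι → Fin M) :=
    ((Equiv.refl ι).arrowCongr (Int.divModEquiv M)).trans (Equiv.arrowProdEquivProdArrow ι _ _)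
  let w (q : ι → ℤ) : ℝ := (2 / (M : ℝ)) ^ s * ‖q‖⁻¹ ^ s
  have hw : Summable w := (summable_inv_norm_pow hs).mul_left _
  have hprod : Summable fun p : (ι → ℤ) × (ι → Fin M) => w p.1 := by
    simpa using hw.mul_of_nonneg (Summable.of_finite (f := fun _ : ι → Fin M => (1 : ℝ)))
      (fun _ => by positivity) (fun _ => zero_le_one)
  have hdiv : Summable fun k => w (divMod k).1 := divMod.summable_iff.2 hprod
  calc ∑' k : {k : ι → ℤ // (M : ℝ) ≤ ‖k‖}, ‖k.1‖⁻¹ ^ s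
      ≤ ∑' k : {k : ι → ℤ // (M : ℝ) ≤ ‖k‖}, w (divMod k).1 :=
        ((summable_inv_norm_pow hs).subtype _).tsum_le_tsum
          (fun k => inv_norm_pow_le_of_le_norm s hM k.2) (hdiv.subtype _)
    _ ≤ ∑' k, w (divMod k).1 := hdiv.tsum_subtype_le _ _ fun _ => by positivity
    _ = ∑' p : (ι → ℤ) × (ι → Fin M), w p.1 := divMod.tsum_eq fun p => w p.1
    _ = M ^ Fintype.card ι * ∑' q, w q := by
        rw [hprod.tsum_prod' fun _ => .of_finite]
        simp [tsum_mul_left]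
    _ = 2 ^ s * (∑' q : ι → ℤ, ‖q‖⁻¹ ^ s) * (M : ℝ) ^ ((Fintype.card ι : ℝ) - s) := by
        rw [tsum_mul_left, Real.rpow_sub hM', Real.rpow_natCast, Real.rpow_natCast, div_pow]
        ring

variable {E : Type*} [SeminormedAddCommGroup E] {a : (ι → ℤ) → E}

theorem norm_pow_mul_eq_mul_inv_norm_pow {k : ι → ℤ} (hk : k ≠ 0) (p j : ℕ) (r : ℝ) :
    ‖k‖ ^ j * r = ‖k‖ ^ (p + j) * r * ‖k‖⁻¹ ^ p := by
  have : ‖k‖ ≠ 0 := norm_ne_zero_iff.2 hk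
  rw [pow_add, inv_pow]
  field_simp

theorem summable_norm_pow_mul_of_le {j n : ℕ} (hn : n ≤ j)
    (ha : Summable fun k => ‖k‖ ^ j * ‖a k‖) : Summable fun k => ‖k‖ ^ n * ‖a k‖ := by
  refine ha.of_norm_bounded_eventually ?_
  filter_upwards [(Set.finite_singleton (0 : ι → ℤ)).compl_mem_cofinite] with k hk
  rw [Real.norm_of_nonneg (by positivity)]
  gcongr
  exact one_le_norm_of_ne_zero hk

theorem summable_norm_pow_mul_of_summable_sq {p j : ℕ} (hp : Fintype.card ι < 2 * p)
    (ha : Summable fun k => (‖k‖ ^ (p + j) * ‖a k‖) ^ 2) :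
    Summable fun k => ‖k‖ ^ j * ‖a k‖ := by
  have hinv : Summable fun k : ι → ℤ => (‖k‖⁻¹ ^ p) ^ 2 := by
    simpa only [← pow_mul'] using summable_inv_norm_pow hp
  refine (summable_mul_of_summable_sq (fun _ => by positivity) (fun _ => by positivity) ha
    hinv).congr_cofinite ?_
  filter_upwards [(Set.finite_singleton (0 : ι → ℤ)).compl_mem_cofinite] with k hk
  exact (norm_pow_mul_eq_mul_inv_norm_pow hk p j _).symm

theorem exists_tsum_norm_pow_mul_le {p j : ℕ} (hp : Fintype.card ι < 2 * p)
    (ha : Summable fun k => (‖k‖ ^ (p + j) * ‖a k‖) ^ 2) :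
    ∃ C : ℝ, 0 ≤ C ∧ ∀ M : ℕ, 0 < M →
      ∑' k : {k : ι → ℤ // (M : ℝ) ≤ ‖k‖}, ‖k.1‖ ^ j * ‖a k‖ ≤
        C * (M : ℝ) ^ (-((p : ℝ) - Fintype.card ι / 2)) := by
  obtain ⟨C, hC₀, hC⟩ := exists_tsum_inv_norm_pow_le hp
  let u (k : ι → ℤ) : ℝ := ‖k‖ ^ (p + j) * ‖a k‖
  refine ⟨√(∑' k, u k ^ 2) * √C, by positivity, fun M hM => ?_⟩
  have hM' : (0 : ℝ) < M := by exact_mod_cast hM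
  have hinv : Summable fun k : ι → ℤ => (‖k‖⁻¹ ^ p) ^ 2 := by
    simpa only [← pow_mul'] using summable_inv_norm_pow hp
  have htail : ∑' k : {k : ι → ℤ // (M : ℝ) ≤ ‖k‖}, (‖k.1‖⁻¹ ^ p) ^ 2 ≤
      C * (M : ℝ) ^ ((Fintype.card ι : ℝ) - (2 * p : ℕ)) := by
    simpa only [← pow_mul'] using hC M hM
  calc ∑' k : {k : ι → ℤ // (M : ℝ) ≤ ‖k‖}, ‖k.1‖ ^ j * ‖a k‖
      = ∑' k : {k : ι → ℤ // (M : ℝ) ≤ ‖k‖}, u k * ‖k.1‖⁻¹ ^ p :=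
        tsum_congr fun k => norm_pow_mul_eq_mul_inv_norm_pow
          (norm_pos_iff.1 (hM'.trans_le k.2)) p j _
    _ ≤ √(∑' k : {k : ι → ℤ // (M : ℝ) ≤ ‖k‖}, u k ^ 2) *
          √(∑' k : {k : ι → ℤ // (M : ℝ) ≤ ‖k‖}, (‖k.1‖⁻¹ ^ p) ^ 2) :=
        tsum_mul_le_sqrt_mul_sqrt (fun _ => by positivity) (fun _ => by positivity)
          (ha.subtype _) (hinv.subtype _)
    _ ≤ √(∑' k, u k ^ 2) * √(C * (M : ℝ) ^ ((Fintype.card ι : ℝ) - (2 * p : ℕ))) := by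
        gcongr
        exact ha.tsum_subtype_le _ _ fun _ => by positivity
    _ = √(∑' k, u k ^ 2) * √C * (M : ℝ) ^ (-((p : ℝ) - Fintype.card ι / 2)) := by
        rw [Real.sqrt_mul hC₀, mul_assoc, Real.sqrt_eq_rpow ((M : ℝ) ^ _), ← Real.rpow_mul hM'.le]
        congr 3
        push_cast
        ring

end Lattice

section Sobolev

variable {d : ℕ} {L : ℝ} {f g : Space d → ℂ}

theorem boxFourierCoeff_of_isPeriodicWeakDeriv (hL : L ≠ 0) {α : Fin d → ℕ}
    (h : IsPeriodicWeakDeriv L α f g) (k : Fin d → ℤ) :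
    boxFourierCoeff L g k =
      (∏ i, (Complex.I * (Real.pi * k i / L : ℝ)) ^ α i) * boxFourierCoeff L f k := by
  have hsymbol : ∏ i, (Complex.I * (Real.pi * (-k) i / L : ℝ)) ^ α i =
      (-1) ^ (∑ i, α i) * ∏ i, (Complex.I * (Real.pi * k i / L : ℝ)) ^ α i := by
    rw [← Finset.prod_pow_eq_pow_sum, ← Finset.prod_mul_distrib]
    refine Finset.prod_congr rfl fun i _ => ?_
    rw [← mul_pow, Pi.neg_apply]
    push_cast
    ring
  have htest := h _ (contDiff_planeWave (-k)) (isPeriodic_planeWave hL (-k))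
  simp only [multiDeriv_planeWave, hsymbol, mul_left_comm (f _), integral_const_mul] at htest
  rw [mul_assoc] at htest
  simp only [boxFourierCoeff, boxMeasure, integral_smul_measure, mul_smul_comm]
  rw [mul_left_cancel₀ (pow_ne_zero _ (neg_ne_zero.2 one_ne_zero)) htest]

theorem norm_boxFourierCoeff_of_isPeriodicWeakDeriv_single (hL : L ≠ 0) {i : Fin d} {m : ℕ}
    (h : IsPeriodicWeakDeriv L (Pi.single i m) f g) (k : Fin d → ℤ) :
    ‖boxFourierCoeff L g k‖ = (Real.pi / |L|) ^ m * (‖k i‖ ^ m * ‖boxFourierCoeff L f k‖) := by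
  have hsymbol : ‖Complex.I * (Real.pi * k i / L : ℝ)‖ = Real.pi / |L| * ‖k i‖ := by
    rw [norm_mul, Complex.norm_I, one_mul, Complex.norm_real, Real.norm_eq_abs, abs_div, abs_mul,
      abs_of_pos Real.pi_pos, Int.norm_eq_abs, mul_div_right_comm]
  rw [boxFourierCoeff_of_isPeriodicWeakDeriv hL h, Fintype.prod_eq_single i fun j hj => by
    rw [Pi.single_eq_of_ne hj, pow_zero], Pi.single_eq_same, norm_mul, norm_pow, hsymbol, mul_pow,
    mul_assoc]

theorem MemPeriodicSobolev.summable_sq_norm_pow_mul_boxFourierCoeff (hL : 0 < L) {m : ℕ}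
    (hf : MemPeriodicSobolev L m f) :
    Summable fun k => (‖k‖ ^ m * ‖boxFourierCoeff L f k‖) ^ 2 := by
  cases isEmpty_or_nonempty (Fin d)
  · exact .of_finite
  have hcoord (i : Fin d) :
      Summable fun k : Fin d → ℤ => (‖k i‖ ^ m * ‖boxFourierCoeff L f k‖) ^ 2 := by
    obtain ⟨g, hg, hfg⟩ := hf.2 (Pi.single i m) (by simp)
    have hparseval := summable_sq_boxFourierCoeff hL hg
    simp only [norm_boxFourierCoeff_of_isPeriodicWeakDeriv_single hL.ne' hfg,
      mul_pow ((Real.pi / |L|) ^ m)] at hparseval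
    exact (summable_mul_left_iff (by positivity)).1 hparseval
  refine (summable_sum fun i (_ : i ∈ Finset.univ) => hcoord i).of_nonneg_of_le
    (fun k => by positivity) fun k => ?_
  obtain ⟨i, hi⟩ := Finite.exists_max fun i => ‖k i‖
  calc (‖k‖ ^ m * ‖boxFourierCoeff L f k‖) ^ 2
      ≤ (‖k i‖ ^ m * ‖boxFourierCoeff L f k‖) ^ 2 := by
        gcongr
        exact (pi_norm_le_iff_of_nonneg (norm_nonneg _)).2 hi
    _ ≤ ∑ i, (‖k i‖ ^ m * ‖boxFourierCoeff L f k‖) ^ 2 :=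
        Finset.single_le_sum (f := fun i => (‖k i‖ ^ m * ‖boxFourierCoeff L f k‖) ^ 2)
          (fun _ _ => by positivity) (Finset.mem_univ i)

end Sobolev

section Aliasing

theorem sum_zpow_pow_of_isPrimitiveRoot {K : Type*} [Field K] {N : ℕ} {ζ : K}
    (hζ : IsPrimitiveRoot ζ N) (j : ℤ) :
    ∑ n : Fin N, (ζ ^ j) ^ (n : ℕ) = if (N : ℤ) ∣ j then (N : K) else 0 := by
  rw [Fin.sum_univ_eq_sum_range fun n => (ζ ^ j) ^ n]
  split_ifs with hj
  · simp [(hζ.zpow_eq_one_iff_dvd j).2 hj]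
  · have hne : ζ ^ j ≠ 1 := mt (hζ.zpow_eq_one_iff_dvd j).1 hj
    have hpow : (ζ ^ j) ^ N = 1 := by
      rw [← zpow_natCast, zpow_comm, zpow_natCast, hζ.pow_eq_one, one_zpow]
    rw [geom_sum_eq hne, hpow, sub_self, zero_div]

variable {d N : ℕ} {L : ℝ}

theorem planeWave_gridPoint (hL : L ≠ 0) (k : Fin d → ℤ) (n : Fin d → Fin N) :
    planeWave L k (gridPoint L N n) =
      ∏ i, (Complex.exp (2 * Real.pi * Complex.I / N) ^ k i) ^ (n i : ℕ) := by
  refine Finset.prod_congr rfl fun i _ => ?_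
  have : (L : ℂ) ≠ 0 := by exact_mod_cast hL
  rw [← Complex.exp_int_mul, ← Complex.exp_nat_mul]
  simp only [gridPoint]
  push_cast
  congr 1
  field_simp
  ring

theorem discreteFourierCoeff_planeWave (hL : L ≠ 0) (hN : N ≠ 0) (k l : Fin d → ℤ) :
    discreteFourierCoeff L N (planeWave L l) k = if ∀ i, (N : ℤ) ∣ l i - k i then 1 else 0 := by
  let ζ := Complex.exp (2 * Real.pi * Complex.I / N)
  have hsum : ∑ n : Fin d → Fin N,
      planeWave L l (gridPoint L N n) * star (planeWave L k (gridPoint L N n)) =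
        ∏ i, if (N : ℤ) ∣ l i - k i then (N : ℂ) else 0 :=
    calc ∑ n : Fin d → Fin N,
          planeWave L l (gridPoint L N n) * star (planeWave L k (gridPoint L N n))
        = ∑ n : Fin d → Fin N, ∏ i, (ζ ^ (l i - k i)) ^ (n i : ℕ) := by
          refine Finset.sum_congr rfl fun n _ => ?_
          rw [← planeWave_neg, ← planeWave_add, ← sub_eq_add_neg, planeWave_gridPoint hL]
          rfl
      _ = ∏ i, ∑ n : Fin N, (ζ ^ (l i - k i)) ^ (n : ℕ) :=
          (Fintype.prod_sum fun i (n : Fin N) => (ζ ^ (l i - k i)) ^ (n : ℕ)).symm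
      _ = ∏ i, if (N : ℤ) ∣ l i - k i then (N : ℂ) else 0 := by
          simp only [ζ, sum_zpow_pow_of_isPrimitiveRoot (Complex.isPrimitiveRoot_exp N hN)]
  rw [discreteFourierCoeff, hsum]
  split_ifs with h
  · rw [Finset.prod_congr rfl fun i _ => if_pos (h i)]
    simp [hN]
  · obtain ⟨i, hi⟩ := not_forall.1 h
    rw [Finset.prod_eq_zero (Finset.mem_univ i) (if_neg hi), mul_zero]

/-- The representative of the frequency `k` modulo `N` with components in `[-N/2, N/2)`, which has
the same plane wave on the grid. -/
def aliasFrequency (N : ℕ) (k : Fin d → ℤ) : Fin d → ℤ := fun i => (k i).bmod N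

theorem mem_frequencies {k : Fin d → ℤ} :
    k ∈ frequencies d N ↔ ∀ i, -((N / 2 : ℕ) : ℤ) ≤ k i ∧ k i < (N / 2 : ℕ) := by
  simp only [frequencies, Fintype.mem_piFinset, Finset.mem_Ico]

theorem aliasFrequency_mem_frequencies (hN : 0 < N) (heven : Even N) (k : Fin d → ℤ) :
    aliasFrequency N k ∈ frequencies d N := by
  refine mem_frequencies.2 fun i => ?_
  have hlower := Int.le_bmod (x := k i) hN
  have hupper := Int.bmod_lt (x := k i) hN
  obtain ⟨M, rfl⟩ := heven
  rw [aliasFrequency]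
  omega

theorem aliasFrequency_eq_iff (hN : 0 < N) {k l : Fin d → ℤ} (hk : k ∈ frequencies d N) :
    aliasFrequency N l = k ↔ ∀ i, (N : ℤ) ∣ l i - k i := by
  refine funext_iff.trans (forall_congr' fun i => ?_)
  obtain ⟨hlower, hupper⟩ := mem_frequencies.1 hk i
  rw [aliasFrequency, Int.bmod_eq_iff hN, dvd_sub_comm]
  exact ⟨fun h => h.2.2, fun h => ⟨by omega, by omega, h⟩⟩

theorem norm_aliasFrequency_le (hN : 0 < N) (k : Fin d → ℤ) :
    ‖aliasFrequency N k‖ ≤ (N / 2 : ℕ) := by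
  refine (pi_norm_le_iff_of_nonneg (Nat.cast_nonneg _)).2 fun i => ?_
  have hlower := Int.le_bmod (x := k i) hN
  have hupper := Int.bmod_lt (x := k i) hN
  have habs : |(k i).bmod N| ≤ (N / 2 : ℕ) := abs_le.2 ⟨by omega, by omega⟩
  rw [aliasFrequency, Int.norm_eq_abs]
  generalize N / 2 = M at habs ⊢
  exact_mod_cast habs

theorem aliasFrequency_of_norm_lt (hN : 0 < N) {k : Fin d → ℤ} (hk : ‖k‖ < (N / 2 : ℕ)) :
    aliasFrequency N k = k := by
  refine (aliasFrequency_eq_iff hN (mem_frequencies.2 fun i => ?_)).2 fun i => by simp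
  have hi := (norm_le_pi_norm k i).trans_lt hk
  rw [Int.norm_eq_abs, abs_lt] at hi
  generalize N / 2 = M at hi ⊢
  exact ⟨by exact_mod_cast hi.1.le, by exact_mod_cast hi.2⟩

theorem norm_aliasFrequency_le_norm (hN : 0 < N) (k : Fin d → ℤ) :
    ‖aliasFrequency N k‖ ≤ ‖k‖ := by
  rcases lt_or_ge ‖k‖ (N / 2 : ℕ) with hk | hk
  · rw [aliasFrequency_of_norm_lt hN hk]
  · exact (norm_aliasFrequency_le hN k).trans hk

theorem interpolant_planeWave (hL : L ≠ 0) (hN : 0 < N) (heven : Even N) (l : Fin d → ℤ) :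
    interpolant L N (planeWave L l) = planeWave L (aliasFrequency N l) := by
  ext x
  rw [interpolant, Finset.sum_eq_single (aliasFrequency N l)]
  · rw [discreteFourierCoeff_planeWave hL hN.ne', if_pos, one_mul]
    exact (aliasFrequency_eq_iff hN (aliasFrequency_mem_frequencies hN heven l)).1 rfl
  · intro k hk hne
    rw [discreteFourierCoeff_planeWave hL hN.ne', if_neg, zero_mul]
    exact fun h => hne ((aliasFrequency_eq_iff hN hk).2 h).symm
  · exact fun h => absurd (aliasFrequency_mem_frequencies hN heven l) h

theorem contDiff_interpolant {n : WithTop ℕ∞} (F : Space d → ℂ) :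
    ContDiff ℝ n (interpolant L N F) :=
  ContDiff.sum fun k _ => contDiff_const.mul (contDiff_planeWave k)

theorem hasSum_interpolant {κ : Type*} {a : κ → ℂ} {f : κ → Space d → ℂ} {F : Space d → ℂ}
    (h : ∀ x, HasSum (fun k => a k * f k x) (F x)) (x : Space d) :
    HasSum (fun k => a k * interpolant L N (f k) x) (interpolant L N F x) := by
  have hsum := hasSum_sum fun l (_ : l ∈ frequencies d N) =>
    ((hasSum_sum fun n (_ : n ∈ (Finset.univ : Finset (Fin d → Fin N))) =>
      (h (gridPoint L N n)).mul_right (star (planeWave L l (gridPoint L N n)))).mul_left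
      (1 / (N : ℂ) ^ d)).mul_right (planeWave L l x)
  refine hsum.congr_fun fun k => ?_
  simp only [interpolant, discreteFourierCoeff, Finset.mul_sum, Finset.sum_mul]
  refine Finset.sum_congr rfl fun l _ => Finset.sum_congr rfl fun n _ => ?_
  ring

end Aliasing

section FourierSeries

variable {d N : ℕ} {L : ℝ} {a : (Fin d → ℤ) → ℂ}

/-- The `2L`-periodic function with Fourier coefficients `a`. -/
def fourierSeries (L : ℝ) (a : (Fin d → ℤ) → ℂ) (x : Space d) : ℂ :=
  ∑' k, a k * planeWave L k x

theorem hasSum_fourierSeries (ha : Summable fun k => ‖a k‖) (x : Space d) :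
    HasSum (fun k => a k * planeWave L k x) (fourierSeries L a x) :=
  (Summable.of_norm (by simpa only [norm_mul, norm_planeWave, mul_one] using ha)).hasSum

theorem isPeriodic_fourierSeries (hL : L ≠ 0) : IsPeriodic L (fourierSeries L a) := fun i x => by
  simp only [fourierSeries, isPeriodic_planeWave hL _ i x]

theorem norm_iteratedFDeriv_const_mul_planeWave_le (c : ℂ) (k : Fin d → ℤ) (n : ℕ) (x : Space d) :
    ‖iteratedFDeriv ℝ n (fun y => c * planeWave L k y) x‖ ≤
      (d * (Real.pi / |L|)) ^ n * (‖k‖ ^ n * ‖c‖) :=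
  calc ‖iteratedFDeriv ℝ n (c • planeWave L k) x‖
      = ‖c‖ * ‖iteratedFDeriv ℝ n (planeWave L k) x‖ := by
        rw [iteratedFDeriv_const_smul_apply (contDiff_planeWave k).contDiffAt, norm_smul]
    _ ≤ ‖c‖ * (d * (Real.pi / |L|) * ‖k‖) ^ n := by
        gcongr
        exact norm_iteratedFDeriv_planeWave_le k n x
    _ = (d * (Real.pi / |L|)) ^ n * (‖k‖ ^ n * ‖c‖) := by ring

theorem contDiff_fourierSeries {j : ℕ} (ha : Summable fun k => ‖k‖ ^ j * ‖a k‖) :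
    ContDiff ℝ j (fourierSeries L a) :=
  contDiff_tsum (v := fun n k => (d * (Real.pi / |L|)) ^ n * (‖k‖ ^ n * ‖a k‖))
    (fun k => contDiff_const.mul (contDiff_planeWave k))
    (fun _ hn => (summable_norm_pow_mul_of_le (by exact_mod_cast hn) ha).mul_left _)
    fun n k x _ => norm_iteratedFDeriv_const_mul_planeWave_le (a k) k n x

theorem norm_iteratedFDeriv_planeWave_sub_alias_le (hN : 0 < N) (c : ℂ) (k : Fin d → ℤ) (n : ℕ)
    (x : Space d) :
    ‖iteratedFDeriv ℝ n
        (fun y => c * planeWave L k y - c * planeWave L (aliasFrequency N k) y) x‖ ≤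
      2 * (d * (Real.pi / |L|)) ^ n * (‖k‖ ^ n * ‖c‖) := by
  have hsmooth (l : Fin d → ℤ) : ContDiffAt ℝ n (fun y => c * planeWave L l y) x :=
    (contDiff_const.mul (contDiff_planeWave l)).contDiffAt
  calc _ = ‖iteratedFDeriv ℝ n (fun y => c * planeWave L k y) x -
          iteratedFDeriv ℝ n (fun y => c * planeWave L (aliasFrequency N k) y) x‖ :=
        congrArg norm (iteratedFDeriv_sub_apply (hsmooth k) (hsmooth _))
    _ ≤ (d * (Real.pi / |L|)) ^ n * (‖k‖ ^ n * ‖c‖) +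
          (d * (Real.pi / |L|)) ^ n * (‖aliasFrequency N k‖ ^ n * ‖c‖) :=
        norm_sub_le_of_le (norm_iteratedFDeriv_const_mul_planeWave_le c k n x)
          (norm_iteratedFDeriv_const_mul_planeWave_le c _ n x)
    _ ≤ (d * (Real.pi / |L|)) ^ n * (‖k‖ ^ n * ‖c‖) +
          (d * (Real.pi / |L|)) ^ n * (‖k‖ ^ n * ‖c‖) := by
        gcongr
        exact norm_aliasFrequency_le_norm hN k
    _ = 2 * (d * (Real.pi / |L|)) ^ n * (‖k‖ ^ n * ‖c‖) := by ring

theorem fourierSeries_sub_interpolant (hL : L ≠ 0) (hN : 0 < N) (heven : Even N)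
    (ha : Summable fun k => ‖a k‖) :
    fourierSeries L a - interpolant L N (fourierSeries L a) =
      fun x => ∑' k : {k : Fin d → ℤ // ((N / 2 : ℕ) : ℝ) ≤ ‖k‖},
        (a k * planeWave L k x - a k * planeWave L (aliasFrequency N k) x) := by
  ext x
  have hseries := hasSum_fourierSeries (L := L) ha
  have herror := (hseries x).sub (hasSum_interpolant (N := N) (L := L) hseries x)
  simp only [interpolant_planeWave hL hN heven] at herror
  rw [Pi.sub_apply, ← herror.tsum_eq]
  refine (tsum_subtype_eq_of_support_subset fun k hk => ?_).symm
  contrapose! hk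
  rw [Function.notMem_support, aliasFrequency_of_norm_lt hN (not_le.1 hk), sub_self]

theorem norm_iteratedFDeriv_fourierSeries_sub_interpolant_le (hL : L ≠ 0) (hN : 0 < N)
    (heven : Even N) {n : ℕ} (ha : Summable fun k => ‖k‖ ^ n * ‖a k‖) (x : Space d) :
    ‖iteratedFDeriv ℝ n (fourierSeries L a - interpolant L N (fourierSeries L a)) x‖ ≤
      2 * (d * (Real.pi / |L|)) ^ n *
        ∑' k : {k : Fin d → ℤ // ((N / 2 : ℕ) : ℝ) ≤ ‖k‖}, ‖k.1‖ ^ n * ‖a k‖ := by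
  let κ := {k : Fin d → ℤ // ((N / 2 : ℕ) : ℝ) ≤ ‖k‖}
  let u (k : κ) (y : Space d) : ℂ :=
    a k * planeWave L k.1 y - a k * planeWave L (aliasFrequency N k.1) y
  let v (q : ℕ) (k : κ) : ℝ := 2 * (d * (Real.pi / |L|)) ^ q * (‖k.1‖ ^ q * ‖a k‖)
  have hu (k : κ) : ContDiff ℝ n (u k) :=
    (contDiff_const.mul (contDiff_planeWave _)).sub (contDiff_const.mul (contDiff_planeWave _))
  have hv (q : ℕ) (hq : q ≤ n) : Summable (v q) :=
    ((summable_norm_pow_mul_of_le hq ha).subtype _).mul_left _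
  have huv (q : ℕ) (k : κ) (y : Space d) : ‖iteratedFDeriv ℝ q (u k) y‖ ≤ v q k :=
    norm_iteratedFDeriv_planeWave_sub_alias_le hN (a k) k.1 q y
  have ha₀ : Summable fun k => ‖a k‖ := by
    simpa using summable_norm_pow_mul_of_le n.zero_le ha
  calc _ = ‖∑' k : κ, iteratedFDeriv ℝ n (u k) x‖ := by
        rw [fourierSeries_sub_interpolant hL hN heven ha₀]
        exact congrArg norm (iteratedFDeriv_tsum_apply hu
          (fun q hq => hv q (by exact_mod_cast hq)) (fun q k y _ => huv q k y) le_rfl x)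
    _ ≤ ∑' k : κ, v n k := tsum_of_norm_bounded (hv n le_rfl).hasSum fun k => huv n k x
    _ = _ := tsum_mul_left

end FourierSeries

section SobolevInterpolation

variable {d m n : ℕ} {L : ℝ} {f : Space d → ℂ}

theorem exists_eq_add_of_half_add_lt (hn : (d : ℝ) / 2 + n < m) :
    ∃ p, m = p + n ∧ Fintype.card (Fin d) < 2 * p := by
  obtain ⟨p, rfl⟩ : ∃ p, m = p + n := Nat.exists_eq_add_of_le' (by
    have : (n : ℝ) < m := by linarith [show (0 : ℝ) ≤ d / 2 by positivity]
    exact_mod_cast this.le)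
  refine ⟨p, rfl, ?_⟩
  rw [Fintype.card_fin]
  push_cast at hn
  exact_mod_cast (by linarith : (d : ℝ) < 2 * p)

theorem MemPeriodicSobolev.summable_norm_pow_mul_boxFourierCoeff (hL : 0 < L)
    (hn : (d : ℝ) / 2 + n < m) (hf : MemPeriodicSobolev L m f) :
    Summable fun k => ‖k‖ ^ n * ‖boxFourierCoeff L f k‖ := by
  obtain ⟨p, rfl, hp⟩ := exists_eq_add_of_half_add_lt hn
  exact summable_norm_pow_mul_of_summable_sq hp
    (hf.summable_sq_norm_pow_mul_boxFourierCoeff hL)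

theorem MemPeriodicSobolev.contDiff_fourierSeries (hL : 0 < L) (hn : (d : ℝ) / 2 + n < m)
    (hf : MemPeriodicSobolev L m f) : ContDiff ℝ n (fourierSeries L (boxFourierCoeff L f)) :=
  SpinBdG.contDiff_fourierSeries (hf.summable_norm_pow_mul_boxFourierCoeff hL hn)

theorem MemPeriodicSobolev.fourierSeries_ae_eq (hL : 0 < L) (hm : (d : ℝ) / 2 < m)
    (hf : MemPeriodicSobolev L m f) :
    fourierSeries L (boxFourierCoeff L f) =ᵐ[volume.restrict (box d L)] f :=
  tsum_boxFourierCoeff_mul_planeWave_ae_eq hL hf.1 <| by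
    simpa using hf.summable_norm_pow_mul_boxFourierCoeff (n := 0) hL (by simpa using hm)

theorem MemPeriodicSobolev.exists_norm_iteratedFDeriv_sub_interpolant_le (hL : 0 < L)
    (hn : (d : ℝ) / 2 + n < m) (hf : MemPeriodicSobolev L m f) :
    ∃ C : ℝ, 0 ≤ C ∧ ∀ N : ℕ, 0 < N → Even N → ∀ x : Space d,
      ‖iteratedFDeriv ℝ n (fourierSeries L (boxFourierCoeff L f) -
        interpolant L N (fourierSeries L (boxFourierCoeff L f))) x‖ ≤
        C * (N : ℝ) ^ (-((m : ℝ) - d / 2 - n)) := by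
  have hsummable := hf.summable_norm_pow_mul_boxFourierCoeff hL hn
  obtain ⟨p, rfl, hp⟩ := exists_eq_add_of_half_add_lt hn
  obtain ⟨C, hC₀, hC⟩ :=
    exists_tsum_norm_pow_mul_le hp (hf.summable_sq_norm_pow_mul_boxFourierCoeff hL)
  let K := 2 * (d * (Real.pi / |L|)) ^ n
  let r := ((p + n : ℕ) : ℝ) - d / 2 - n
  have hr : (p : ℝ) - Fintype.card (Fin d) / 2 = r := by
    simp only [r, Fintype.card_fin]
    push_cast
    ring
  refine ⟨K * (C * 2 ^ r), by positivity, fun N hN heven x => ?_⟩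
  have hhalf : 0 < N / 2 := by
    obtain ⟨M, rfl⟩ := heven
    omega
  have hrescale : ((N / 2 : ℕ) : ℝ) ^ (-r) = 2 ^ r * (N : ℝ) ^ (-r) := by
    rw [Nat.cast_div heven.two_dvd (by norm_num), Nat.cast_two,
      Real.div_rpow N.cast_nonneg zero_le_two, Real.rpow_neg zero_le_two, div_inv_eq_mul, mul_comm]
  have htail := hC (N / 2) hhalf
  rw [hr, hrescale] at htail
  calc _ ≤ K * ∑' k : {k : Fin d → ℤ // ((N / 2 : ℕ) : ℝ) ≤ ‖k‖},
          ‖k.1‖ ^ n * ‖boxFourierCoeff L f k‖ :=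
        norm_iteratedFDeriv_fourierSeries_sub_interpolant_le hL.ne' hN heven hsummable x
    _ ≤ K * (C * (2 ^ r * (N : ℝ) ^ (-r))) := by gcongr
    _ = K * (C * 2 ^ r) * (N : ℝ) ^ (-r) := by ring

end SobolevInterpolation

section Laplacian

variable {d : ℕ} {L : ℝ} {f : Space d → ℂ} {m : ℕ}

theorem norm_laplacian_le {E F : Type*} [NormedAddCommGroup E] [InnerProductSpace ℝ E]
    [FiniteDimensional ℝ E] [NormedAddCommGroup F] [NormedSpace ℝ F] (f : E → F) (x : E) :
    ‖Laplacian.laplacian f x‖ ≤ Module.finrank ℝ E * ‖iteratedFDeriv ℝ 2 f x‖ := by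
  let e := stdOrthonormalBasis ℝ E
  rw [InnerProductSpace.laplacian_eq_iteratedFDeriv_orthonormalBasis f e]
  calc ‖∑ i, iteratedFDeriv ℝ 2 f x ![e i, e i]‖
      ≤ ∑ _ : Fin (Module.finrank ℝ E), ‖iteratedFDeriv ℝ 2 f x‖ :=
        norm_sum_le_of_le _ fun i _ => by
          simpa [Fin.prod_univ_two] using (iteratedFDeriv ℝ 2 f x).le_opNorm ![e i, e i]
    _ = Module.finrank ℝ E * ‖iteratedFDeriv ℝ 2 f x‖ := by simp

/-- The interpolation errors of `F` and of its Laplacian are `O(N ^ r)`, uniformly in space, as the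
even number `N` of grid points per coordinate grows. -/
def HasInterpolationRate (L r : ℝ) (F : Space d → ℂ) : Prop :=
  ∃ C : ℝ, ∀ N : ℕ, 0 < N → Even N → ∀ x : Space d,
    ‖F x - interpolant L N F x‖ ≤ C * (N : ℝ) ^ r ∧
    ‖Laplacian.laplacian F x - Laplacian.laplacian (interpolant L N F) x‖ ≤ C * (N : ℝ) ^ r

theorem MemPeriodicSobolev.hasInterpolationRate_fourierSeries (hL : 0 < L)
    (hm : (d : ℝ) / 2 + 2 < m) (hf : MemPeriodicSobolev L m f) :
    HasInterpolationRate L (-((m : ℝ) - d / 2 - 2)) (fourierSeries L (boxFourierCoeff L f)) := by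
  have hF := hf.contDiff_fourierSeries (n := 2) hL (by simpa using hm)
  obtain ⟨C₀, hC₀, h₀⟩ :=
    hf.exists_norm_iteratedFDeriv_sub_interpolant_le (n := 0) hL (by push_cast; linarith)
  obtain ⟨C₂, hC₂, h₂⟩ :=
    hf.exists_norm_iteratedFDeriv_sub_interpolant_le (n := 2) hL (by simpa using hm)
  refine ⟨C₀ + d * C₂, fun N hN heven x => ?_⟩
  have hN₁ : (1 : ℝ) ≤ N := by exact_mod_cast hN
  rw [add_mul]
  constructor
  · refine le_add_of_le_of_nonneg ?_ (by positivity)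
    calc _ ≤ C₀ * (N : ℝ) ^ (-((m : ℝ) - d / 2 - (0 : ℕ))) := by
          simpa only [norm_iteratedFDeriv_zero, Pi.sub_apply] using h₀ N hN heven x
      _ ≤ C₀ * (N : ℝ) ^ (-((m : ℝ) - d / 2 - 2)) := by
          gcongr
          norm_num
  · refine le_add_of_nonneg_of_le (by positivity) ?_
    rw [← hF.contDiffAt.laplacian_sub (contDiff_interpolant _).contDiffAt]
    calc _ ≤ d * ‖iteratedFDeriv ℝ 2 _ x‖ := by
          simpa only [finrank_euclideanSpace_fin] using norm_laplacian_le _ x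
      _ ≤ d * (C₂ * (N : ℝ) ^ (-((m : ℝ) - d / 2 - (2 : ℕ)))) := by
          gcongr
          exact h₂ N hN heven x
      _ = d * C₂ * (N : ℝ) ^ (-((m : ℝ) - d / 2 - 2)) := by rw [mul_assoc, Nat.cast_two]

end Laplacian

section Operators

open scoped Matrix.Norms.Operator

variable {d : ℕ} {L : ℝ}

theorem isBounded_image_comp {X P Q : Type*} [PseudoMetricSpace P] [ProperSpace P]
    [PseudoMetricSpace Q] {c : P → Q} (hc : Continuous c) {g : X → P} {s : Set X}
    (hg : Bornology.IsBounded (g '' s)) : Bornology.IsBounded ((fun x => c (g x)) '' s) := by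
  rw [← Set.image_image c g]
  exact (hg.isCompact_closure.image hc).isBounded.subset (Set.image_mono subset_closure)

theorem continuous_coeffA (βn βs : ℝ) : Continuous (coeffA βn βs) := by
  unfold coeffA density spinVector
  fun_prop

theorem continuous_coeffB (βn βs : ℝ) : Continuous (coeffB βn βs) := by
  unfold coeffB
  fun_prop

theorem supNorm_le {χ : Space d → Fin 3 → ℂ} {C : ℝ} (h : ∀ j, ∀ x ∈ box d L, ‖χ x j‖ ≤ C) :
    supNorm L χ ≤ ENNReal.ofReal C :=
  iSup_le fun j => iSup₂_le fun x hx => by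
    rw [← ofReal_norm]
    exact ENNReal.ofReal_le_ofReal (h j x hx)

/-- The second-order operator `κ ∇² + M` on vector-valued functions, with a matrix potential `M`.
Both Bogoliubov–de Gennes operators are of this form. -/
def laplacianAddMulVec {ι : Type*} [Fintype ι] (κ : ℂ) (M : Space d → Matrix ι ι ℂ)
    (χ : Space d → ι → ℂ) : Space d → ι → ℂ :=
  fun x j => κ * Laplacian.laplacian (fun y => χ y j) x + (M x *ᵥ χ x) j

/-- The matrix potential of `𝒜`, that is, `𝒜` without its kinetic term `-½∇²`. -/
def potentialA (V : Space d → ℝ) (μ : Fin 3 → ℝ) (βn βs : ℝ) (Φ : Space d → Fin 3 → ℂ)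
    (x : Space d) : Matrix (Fin 3) (Fin 3) ℂ :=
  (V x : ℂ) • 1 - Matrix.diagonal (fun j => (μ j : ℂ)) + coeffA βn βs (Φ x)

theorem opA_eq_laplacianAddMulVec (V : Space d → ℝ) (μ : Fin 3 → ℝ) (βn βs : ℝ)
    (Φ : Space d → Fin 3 → ℂ) :
    opA V μ βn βs Φ = laplacianAddMulVec (-(1 / 2)) (potentialA V μ βn βs Φ) := by
  ext χ x j
  simp only [opA, laplacianAddMulVec, potentialA, Matrix.add_mulVec, Matrix.sub_mulVec,
    Matrix.smul_mulVec, Matrix.one_mulVec, Matrix.mulVec_diagonal, Pi.add_apply, Pi.sub_apply,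
    Pi.smul_apply, smul_eq_mul]
  ring

theorem opB_eq_laplacianAddMulVec (βn βs : ℝ) (Φ : Space d → Fin 3 → ℂ) :
    opB βn βs Φ = laplacianAddMulVec 0 fun x => coeffB βn βs (Φ x) := by
  ext χ x j
  rw [opB, laplacianAddMulVec, zero_mul, zero_add]

theorem norm_laplacianAddMulVec_sub_le {ι : Type*} [Fintype ι] (κ : ℂ)
    {M : Space d → Matrix ι ι ℂ} {χ ψ : Space d → ι → ℂ} {x : Space d} {R ε : ℝ}
    (hM : ‖M x‖ ≤ R) (hε : ∀ j, ‖χ x j - ψ x j‖ ≤ ε)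
    (hΔ : ∀ j, ‖Laplacian.laplacian (fun y => χ y j) x -
      Laplacian.laplacian (fun y => ψ y j) x‖ ≤ ε) (j : ι) :
    ‖(laplacianAddMulVec κ M χ - laplacianAddMulVec κ M ψ) x j‖ ≤ (‖κ‖ + R) * ε := by
  have hε₀ : 0 ≤ ε := (norm_nonneg _).trans (hε j)
  have hmulVec : ‖(M x *ᵥ (χ x - ψ x)) j‖ ≤ R * ε :=
    calc _ ≤ ‖M x *ᵥ (χ x - ψ x)‖ := norm_le_pi_norm _ j
      _ ≤ ‖M x‖ * ‖χ x - ψ x‖ := Matrix.linfty_opNorm_mulVec _ _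
      _ ≤ R * ε := mul_le_mul hM ((pi_norm_le_iff_of_nonneg hε₀).2 hε) (norm_nonneg _)
          ((norm_nonneg _).trans hM)
  calc _ = ‖κ * (Laplacian.laplacian (fun y => χ y j) x -
          Laplacian.laplacian (fun y => ψ y j) x) + (M x *ᵥ (χ x - ψ x)) j‖ := by
        rw [Pi.sub_apply, Pi.sub_apply, laplacianAddMulVec, laplacianAddMulVec,
          Matrix.mulVec_sub, Pi.sub_apply]
        ring_nf
    _ ≤ ‖κ‖ * ε + R * ε := by
        refine norm_add_le_of_le ?_ hmulVec
        rw [norm_mul]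
        gcongr
        exact hΔ j
    _ = (‖κ‖ + R) * ε := by ring

theorem exists_supNorm_laplacianAddMulVec_sub_le (κ : ℂ)
    {M : Space d → Matrix (Fin 3) (Fin 3) ℂ} (hM : Bornology.IsBounded (M '' box d L))
    {χ : Space d → Fin 3 → ℂ} {r : ℝ}
    (hχ : ∀ j, HasInterpolationRate L r fun x => χ x j) :
    ∃ c : ℝ, 0 < c ∧ ∀ N : ℕ, 0 < N → Even N →
      supNorm L (laplacianAddMulVec κ M χ - laplacianAddMulVec κ M (vecInterpolant L N χ)) ≤
        ENNReal.ofReal (c * (N : ℝ) ^ r) := by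
  obtain ⟨R, hR₀, hR⟩ := hM.exists_pos_norm_le
  choose C hC using hχ
  obtain ⟨K, hK⟩ := (Set.finite_range C).bddAbove
  replace hK (j : Fin 3) : C j ≤ max K 1 := (hK ⟨j, rfl⟩).trans (le_max_left _ _)
  refine ⟨(‖κ‖ + R) * max K 1, by positivity, fun N hN heven => supNorm_le fun j x hx => ?_⟩
  have hle (i : Fin 3) : C i * (N : ℝ) ^ r ≤ max K 1 * (N : ℝ) ^ r := by
    gcongr
    exact hK i
  rw [mul_assoc]
  exact norm_laplacianAddMulVec_sub_le κ (hR _ ⟨x, hx, rfl⟩)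
    (fun i => (hC i N hN heven x).1.trans (hle i)) (fun i => (hC i N hN heven x).2.trans (hle i)) j

theorem isBounded_image_potentialA {V : Space d → ℝ} (hV : Bornology.IsBounded (V '' box d L))
    {Φ : Space d → Fin 3 → ℂ} (hΦ : Bornology.IsBounded (Φ '' box d L)) (μ : Fin 3 → ℝ)
    (βn βs : ℝ) : Bornology.IsBounded (potentialA V μ βn βs Φ '' box d L) := by
  have hc : Continuous fun p : ℝ × (Fin 3 → ℂ) =>
      (p.1 : ℂ) • 1 - Matrix.diagonal (fun j => (μ j : ℂ)) + coeffA βn βs p.2 :=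
    ((by fun_prop : Continuous fun p : ℝ × (Fin 3 → ℂ) => (p.1 : ℂ) •
      (1 : Matrix (Fin 3) (Fin 3) ℂ)).sub continuous_const).add
      ((continuous_coeffA βn βs).comp continuous_snd)
  refine isBounded_image_comp hc (g := fun x => (V x, Φ x)) ((hV.prod hΦ).subset ?_)
  rintro _ ⟨x, hx, rfl⟩
  exact ⟨⟨x, hx, rfl⟩, ⟨x, hx, rfl⟩⟩

theorem exists_supNorm_opA_sub_le {V : Space d → ℝ} (hV : Bornology.IsBounded (V '' box d L))
    {Φ : Space d → Fin 3 → ℂ} (hΦ : Bornology.IsBounded (Φ '' box d L)) (μ : Fin 3 → ℝ)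
    (βn βs : ℝ) {χ : Space d → Fin 3 → ℂ} {r : ℝ}
    (hχ : ∀ j, HasInterpolationRate L r fun x => χ x j) :
    ∃ c : ℝ, 0 < c ∧ ∀ N : ℕ, 0 < N → Even N →
      supNorm L (opA V μ βn βs Φ χ - opA V μ βn βs Φ (vecInterpolant L N χ)) ≤
        ENNReal.ofReal (c * (N : ℝ) ^ r) := by
  rw [opA_eq_laplacianAddMulVec]
  exact exists_supNorm_laplacianAddMulVec_sub_le _ (isBounded_image_potentialA hV hΦ μ βn βs) hχ

theorem exists_supNorm_opB_sub_le (βn βs : ℝ) {Φ : Space d → Fin 3 → ℂ}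
    (hΦ : Bornology.IsBounded (Φ '' box d L)) {χ : Space d → Fin 3 → ℂ} {r : ℝ}
    (hχ : ∀ j, HasInterpolationRate L r fun x => χ x j) :
    ∃ c : ℝ, 0 < c ∧ ∀ N : ℕ, 0 < N → Even N →
      supNorm L (opB βn βs Φ χ - opB βn βs Φ (vecInterpolant L N χ)) ≤
        ENNReal.ofReal (c * (N : ℝ) ^ r) := by
  rw [opB_eq_laplacianAddMulVec]
  exact exists_supNorm_laplacianAddMulVec_sub_le _
    (isBounded_image_comp (continuous_coeffB βn βs) hΦ) hχ

end Operators

end SpinBdG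

end

theorem mainTheorem7_general (d : ℕ) (L : ℝ) (hL : 0 < L)
    (V : SpinBdG.Space d → ℝ) (hV : Bornology.IsBounded (V '' SpinBdG.box d L))
    (Φ : SpinBdG.Space d → Fin 3 → ℂ) (hΦ : Bornology.IsBounded (Φ '' SpinBdG.box d L))
    (μ : Fin 3 → ℝ) (βn βs : ℝ)
    (m : ℕ) (hm : (d : ℝ) / 2 + 2 < m)
    (χ : SpinBdG.Space d → Fin 3 → ℂ)
    (hχ : ∀ j, SpinBdG.MemPeriodicSobolev L m (fun x => χ x j)) :
    ∃ χ' : SpinBdG.Space d → Fin 3 → ℂ,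
      (∀ j, ContDiff ℝ 2 (fun x => χ' x j) ∧ SpinBdG.IsPeriodic L (fun x => χ' x j)) ∧
      χ' =ᵐ[MeasureTheory.volume.restrict (SpinBdG.box d L)] χ ∧
      ∀ Q : (SpinBdG.Space d → Fin 3 → ℂ) → SpinBdG.Space d → Fin 3 → ℂ,
        Q = SpinBdG.opA V μ βn βs Φ ∨ Q = SpinBdG.opB βn βs Φ →
        ∃ c : ℝ, 0 < c ∧ ∀ N : ℕ, 0 < N → Even N →
          SpinBdG.supNorm L (Q χ' - Q (SpinBdG.vecInterpolant L N χ')) ≤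
            ENNReal.ofReal (c * (N : ℝ) ^ (-((m : ℝ) - (d : ℝ) / 2 - 2))) := by
  have hrate j := (hχ j).hasInterpolationRate_fourierSeries hL hm
  have hae : ∀ᵐ x ∂volume.restrict (SpinBdG.box d L), ∀ j,
      SpinBdG.fourierSeries L (SpinBdG.boxFourierCoeff L fun x => χ x j) x = χ x j :=
    ae_all_iff.2 fun j => (hχ j).fourierSeries_ae_eq hL (by linarith)
  refine ⟨fun x j => SpinBdG.fourierSeries L (SpinBdG.boxFourierCoeff L fun x => χ x j) x,
    fun j => ⟨(hχ j).contDiff_fourierSeries (n := 2) hL (by simpa using hm),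
      SpinBdG.isPeriodic_fourierSeries hL.ne'⟩,
    hae.mono fun x hx => funext hx, ?_⟩
  rintro Q (rfl | rfl)
  · exact SpinBdG.exists_supNorm_opA_sub_le hV hΦ μ βn βs hrate
  · exact SpinBdG.exists_supNorm_opB_sub_le βn βs hΦ hrate

theorem mainTheorem7 (d : ℕ) (hd : 1 ≤ d) (hd3 : d ≤ 3) (L : ℝ) (hL : 0 < L)
    (V : SpinBdG.Space d → ℝ) (hV : Bornology.IsBounded (V '' SpinBdG.box d L))
    (Φ : SpinBdG.Space d → Fin 3 → ℂ) (hΦ : Bornology.IsBounded (Φ '' SpinBdG.box d L))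
    (μ : Fin 3 → ℝ) (βn βs : ℝ)
    (m : ℕ) (hm : (d : ℝ) / 2 + 2 < m)
    (χ : SpinBdG.Space d → Fin 3 → ℂ)
    (hχ : ∀ j, SpinBdG.MemPeriodicSobolev L m (fun x => χ x j)) :
    -- `χ'` is the continuous periodic representative of the class of `χ`; it is of class `C²`
    ∃ χ' : SpinBdG.Space d → Fin 3 → ℂ,
      (∀ j, ContDiff ℝ 2 (fun x => χ' x j) ∧ SpinBdG.IsPeriodic L (fun x => χ' x j)) ∧
      χ' =ᵐ[MeasureTheory.volume.restrict (SpinBdG.box d L)] χ ∧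
      ∀ Q : (SpinBdG.Space d → Fin 3 → ℂ) → SpinBdG.Space d → Fin 3 → ℂ,
        Q = SpinBdG.opA V μ βn βs Φ ∨ Q = SpinBdG.opB βn βs Φ →
        ∃ c : ℝ, 0 < c ∧ ∀ N : ℕ, 0 < N → Even N →
          SpinBdG.supNorm L (Q χ' - Q (SpinBdG.vecInterpolant L N χ')) ≤
            ENNReal.ofReal (c * (N : ℝ) ^ (-((m : ℝ) - (d : ℝ) / 2 - 2))) :=
  mainTheorem7_general d L hL V hV Φ hΦ μ βn βs m hm χ hχ
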